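/- Let $\mathcal G$ be any set and let $A=\{A(i,j)\}_{i,j\in\mathcal G}$ be a matrix with entries in $\{0,1\}$ and no zero rows. *Semigroupoids.* A semigroupoid is a set $\Lambda$ with a subset $\Lambda^{(2)}\subseteq\Lambda\times\Lambda$ and an operation $\Lambda^{(2)}\to\Lambda$, $(f,g)\mapsto fg$, such that whenever (i) $(f,g),(g,h)\in\Lambda^{(2)}$, or (ii) $(f,g),(fg,h)\in\Lambda^{(2)}$, or (iii) $(g,h),(f,gh)\in\Lambda^{(2)}$, then $(f,g),(g,h),(fg,h),(f,gh)\in\Lambda^{(2)}$ and $(fg)h=f(gh)$. One writes $f\mid g$ if $f=g$ or $fh=g$ for some $h$ with $(f,h)\in\Lambda^{(2)}$; $f$ and $g$ intersect if there is $m\in\Lambda$ with $f\mid m$ and $g\mid m$, and otherwise they are disjoint. Put $\Lambda^f=\{g:(f,g)\in\Lambda^{(2)}\}$ for $f\in\Lambda$, let $\tilde\Lambda=\Lambda\,\dot\cup\,\{1\}$ and $\Lambda^1=\Lambda$. For finite $F,G\subseteq\tilde\Lambda$ let $\Lambda^{F,G}=\{h\in\Lambda: h\in\Lambda^f\ \forall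 f\in F,\ h\notin\Lambda^g\ \forall g\in G\}$. A covering of $X\subseteq\Lambda$ is a subset $H\subseteq X$ such that every $f\in X$ intersects some $h\in H$. *Representations.* A representation of $\Lambda$ in a unital C*-algebra $B$ is a map $S:\Lambda\to B$ by partial isometries such that $S_fS_g=S_{fg}$ if $(f,g)\in\Lambda^{(2)}$ and $S_fS_g=0$ otherwise, the projections $Q_f=S_f^*S_f$ and $P_g=S_gS_g^*$ ($f,g\in\Lambda$) all commute with one another, $P_fP_g=0$ if $f$ and $g$ are disjoint, and $Q_fP_g=P_g$ if $(f,g)\in\Lambda^{(2)}$. Put $Q_1=1$. The representation is tight if $$\bigvee_{h\in H}P_h=\prod_{f\in F}Q_f\prod_{g\in G}(1-Q_g)$$ for all finite $F,G\subseteq\tilde\Lambda$ and every finite covering $H$ of $\Lambda^{F,G}$. The algebra $\tilde{\mathcal O}(\Lambda)$ is the universal unital C*-algebra generated by partial isometries $\{S_f\}_{f\in\Lambda}$ subject to the relations that $f\mapsto S_f$ is a tight representation. *The two algebras.* Let $\Lambda_A$ be the Markov semigroupoid: its elements are the words $\alpha_1\cdots\alpha_n$ in $\mathcal G$ with $n\ge1$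 and $A(\alpha_i,\alpha_{i+1})=1$ for $1\le i<n$; the pair $(\alpha_1\cdots\alpha_n,\beta_1\cdots\beta_m)$ is composable iff $A(\alpha_n,\beta_1)=1$, and the product is concatenation. Let $\tilde{\mathcal O}_A$ be the unital Exel–Laca Cuntz–Krieger algebra: the universal unital C*-algebra generated by partial isometries $\{S_x\}_{x\in\mathcal G}$ subject to the following relations, where $Q_x=S_x^*S_x$ and $P_x=S_xS_x^*$: the $Q_x$ commute with one another; $S_i^*S_j=0$ for $i\ne j$; $Q_iS_j=A(i,j)S_j$ for all $i,j$; and $$\prod_{x\in X}Q_x\prod_{y\in Y}(1-Q_y)=\sum_{j\in\mathcal G}A(X,Y,j)P_j,\qquad A(X,Y,j):=\prod_{x\in X}A(x,j)\prod_{y\in Y}(1-A(y,j)),$$ for all finite $X,Y\subseteq\mathcal G$ such that $A(X,Y,j)=0$ for all but finitely many $j$. **Theorem.** The C*-algebras $\tilde{\mathcal O}(\Lambda_A)$ and $\tilde{\mathcal O}_A$ are *-isomorphic. -/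

import Mathlib

open scoped ENNReal

universe u v

noncomputable section

/-! ### Partial isometries and universal unital C*-algebras -/

section PartialIsometry

variable {B : Type v} [CStarAlgebra B]

/-- `s` is a partial isometry: `s s* s = s`. -/
def IsPartialIsometry (s : B) : Prop := s * star s * s = s

/-- The initial projection `s* s`. -/
def iniProj (s : B) : B := star s * s

/-- The final projection `s s*`. -/
def finProj (s : B) : B := s * star s

theorem IsPartialIsometry.norm_le_one {s : B} (hs : IsPartialIsometry s) : ‖s‖ ≤ 1 := by
  have h1 : (star s * s) * (star s * s) = star s * s := by
    rw [mul_assoc, ← mul_assoc s, hs]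
  have h2 : ‖star s * s‖ * ‖star s * s‖ = ‖star s * s‖ := by
    conv_rhs => rw [← h1]
    rw [← CStarRing.norm_star_mul_self]
    simp
  have h3 := CStarRing.norm_star_mul_self (x := s)
  rw [h3] at h2
  by_contra h
  push Not at h
  nlinarith [mul_pos (by linarith : 0 < ‖s‖) (by linarith : 0 < ‖s‖),
    mul_lt_mul'' h h (by norm_num) (by norm_num)]

end PartialIsometry

/-- A system of relations on a family of partial isometries indexed by `X`: a condition on
`X`-indexed families in unital C*-algebras that forces every member to be a partial isometry. -/
structure PartialIsometryRelations (X : Type u) where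
  Holds : ∀ (B : Type u) [CStarAlgebra B], (X → B) → Prop
  isPartialIsometry : ∀ (B : Type u) [CStarAlgebra B] (S : X → B),
    Holds B S → ∀ x, IsPartialIsometry (S x)

namespace PartialIsometryRelations

variable {X : Type u} (R : PartialIsometryRelations X)

/-- A family satisfying the relations in a nonzero unital C*-algebra. (The zero algebra contributes
nothing to the universal norm. Every C*-algebra generated by an `X`-indexed family has an isomorphic
copy in `Type u`, so that nothing is lost by the restriction to this universe either.) -/
structure Model where
  carrier : Type u
  [cstarAlgebra : CStarAlgebra carrier]
  [nontrivial : Nontrivial carrier]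
  family : X → carrier
  holds : R.Holds carrier family

attribute [instance] Model.cstarAlgebra Model.nontrivial

/-- The C*-algebra of bounded functions choosing an element of each model. -/
def Product : Type (u + 1) := lp (fun M : R.Model => M.carrier) ∞

instance lpCStarAlgebra (ι : Type v) (B : ι → Type u) [∀ i, CStarAlgebra (B i)] [∀ i, Nontrivial (B i)] :
    CStarAlgebra (lp B ∞) where

instance : CStarAlgebra R.Product :=
  inferInstanceAs (CStarAlgebra (lp (fun M : R.Model => M.carrier) ∞))

/-- The family in the product whose coordinate at each model is the family of that model. -/
def productFamily (x : X) : R.Product :=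
  ⟨fun M => M.family x, memℓp_infty ⟨1, by
    rintro _ ⟨M, rfl⟩
    exact (R.isPartialIsometry M.carrier M.family M.holds x).norm_le_one⟩⟩

/-- The universal unital C*-algebra generated by partial isometries indexed by `X` subject to the
relations `R`: the closed unital *-subalgebra generated by the diagonal family inside the product
over all models. Equivalently, it is the completion of the free unital *-algebra on `X` in the
largest C*-seminorm that comes from a family satisfying the relations. -/
def universalSubalgebra : StarSubalgebra ℂ R.Product :=
  (StarAlgebra.adjoin ℂ (Set.range R.productFamily)).topologicalClosure

/-- The universal unital C*-algebra as a type. -/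
def Universal : Type (u + 1) := R.universalSubalgebra

instance : IsClosed (R.universalSubalgebra : Set R.Product) :=
  StarSubalgebra.isClosed_topologicalClosure _

instance : CStarAlgebra R.Universal := StarSubalgebra.cstarAlgebra R.universalSubalgebra

/-- The standard generators. -/
def generator (x : X) : R.Universal :=
  ⟨R.productFamily x, StarSubalgebra.le_topologicalClosure _
    (StarAlgebra.subset_adjoin ℂ _ ⟨x, rfl⟩)⟩

end PartialIsometryRelations

/-! ### Semigroupoids -/

/-- A semigroupoid: a set `Λ` with a partially defined operation, whose domain is the set of
composable pairs, which is associative in the strong sense. -/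
class Semigroupoid (Λ : Type u) where
  Composable : Λ → Λ → Prop
  comp : ∀ f g : Λ, Composable f g → Λ
  assoc_basic : ∀ (f g h : Λ) (hfg : Composable f g) (hgh : Composable g h),
    ∃ (h₁ : Composable (comp f g hfg) h) (h₂ : Composable f (comp g h hgh)),
      comp (comp f g hfg) h h₁ = comp f (comp g h hgh) h₂
  assoc_left : ∀ (f g h : Λ) (hfg : Composable f g) (h₁ : Composable (comp f g hfg) h),
    ∃ (hgh : Composable g h) (h₂ : Composable f (comp g h hgh)),
      comp (comp f g hfg) h h₁ = comp f (comp g h hgh) h₂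
  assoc_right : ∀ (f g h : Λ) (hgh : Composable g h) (h₂ : Composable f (comp g h hgh)),
    ∃ (hfg : Composable f g) (h₁ : Composable (comp f g hfg) h),
      comp (comp f g hfg) h h₁ = comp f (comp g h hgh) h₂

namespace Semigroupoid

variable {Λ : Type u} [Semigroupoid Λ]

/-- `f` divides `g`. -/
def Divides (f g : Λ) : Prop := f = g ∨ ∃ (h : Λ) (hfh : Composable f h), comp f h hfh = g

/-- `f` and `g` have a common multiple. -/
def Intersects (f g : Λ) : Prop := ∃ m : Λ, Divides f m ∧ Divides g m

/-- The set `Λ^f` of elements that can be multiplied on the left by `f`, for `f` in the unitization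
`Λ ∪ {1}`, modelled by `Option Λ` with `none` as the extra unit; `Λ^1 = Λ`. -/
def rightDomain : Option Λ → Set Λ
  | none => Set.univ
  | some f => {g | Composable f g}

/-- The set `Λ^{F,G}`: the intersection of the `Λ^f` for `f ∈ F` and of the complements of the `Λ^g`
for `g ∈ G`. -/
def domainSet (F G : Finset (Option Λ)) : Set Λ :=
  {h | (∀ f ∈ F, h ∈ rightDomain f) ∧ ∀ g ∈ G, h ∉ rightDomain g}

/-- `H` is a covering of `X`. -/
def IsCovering (H X : Set Λ) : Prop := H ⊆ X ∧ ∀ f ∈ X, ∃ h ∈ H, Intersects h f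

variable {B : Type v} [CStarAlgebra B]

/-- A representation of a semigroupoid in a unital C*-algebra. -/
structure IsRepresentation (S : Λ → B) : Prop where
  isPartialIsometry : ∀ f, IsPartialIsometry (S f)
  mul_of_composable : ∀ (f g : Λ) (h : Composable f g), S f * S g = S (comp f g h)
  mul_of_not_composable : ∀ f g : Λ, ¬ Composable f g → S f * S g = 0
  commute_ini_ini : ∀ f g : Λ, Commute (iniProj (S f)) (iniProj (S g))
  commute_fin_fin : ∀ f g : Λ, Commute (finProj (S f)) (finProj (S g))
  commute_ini_fin : ∀ f g : Λ, Commute (iniProj (S f)) (finProj (S g))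
  fin_mul_fin_of_disjoint : ∀ f g : Λ, ¬ Intersects f g → finProj (S f) * finProj (S g) = 0
  ini_mul_fin : ∀ f g : Λ, Composable f g → iniProj (S f) * finProj (S g) = finProj (S g)

/-- The initial projections `Q_f` for `f` in the unitization, with `Q_1 = 1`. -/
def iniExt (S : Λ → B) : Option Λ → B
  | none => 1
  | some f => iniProj (S f)

theorem IsRepresentation.commute_iniExt {S : Λ → B} (hS : IsRepresentation S) (f g : Option Λ) :
    Commute (iniExt S f) (iniExt S g) := by
  cases f <;> cases g <;> simp [iniExt, hS.commute_ini_ini]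

theorem IsRepresentation.commute_one_sub_iniExt {S : Λ → B} (hS : IsRepresentation S)
    (f g : Option Λ) : Commute (1 - iniExt S f) (1 - iniExt S g) :=
  (Commute.one_left _).sub_left ((Commute.one_right _).sub_right (hS.commute_iniExt f g))

theorem IsRepresentation.commute_one_sub_fin {S : Λ → B} (hS : IsRepresentation S)
    (f g : Λ) : Commute (1 - finProj (S f)) (1 - finProj (S g)) :=
  (Commute.one_left _).sub_left ((Commute.one_right _).sub_right (hS.commute_fin_fin f g))

/-- A tight representation. The supremum of the finitely many commuting projections `P_h`, `h ∈ H`,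
where `P ∨ P' = P + P' - P P'`, is written as `1 - ∏ (1 - P_h)`. -/
structure IsTight (S : Λ → B) : Prop extends IsRepresentation S where
  tight : ∀ (F G : Finset (Option Λ)) (H : Finset Λ),
    IsCovering (H : Set Λ) (domainSet F G) →
    1 - H.noncommProd (fun h => 1 - finProj (S h))
        (fun f _ g _ _ => toIsRepresentation.commute_one_sub_fin f g) =
      F.noncommProd (fun f => iniExt S f) (fun f _ g _ _ => toIsRepresentation.commute_iniExt f g) *
      G.noncommProd (fun g => 1 - iniExt S g)
        (fun f _ g _ _ => toIsRepresentation.commute_one_sub_iniExt f g)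

variable (Λ)

/-- The relations saying that `f ↦ S_f` is a tight representation. -/
def tightRelations : PartialIsometryRelations Λ where
  Holds _ _ S := IsTight S
  isPartialIsometry _ _ _ h := h.isPartialIsometry

/-- The unital semigroupoid C*-algebra. -/
abbrev UnitalCStarAlgebra : Type (u + 1) := (tightRelations Λ).Universal

end Semigroupoid

/-! ### The Markov semigroupoid of a 0-1 matrix -/

section Markov

variable {𝒢 : Type u} (A : Matrix 𝒢 𝒢 ℤ)

/-- Nonempty finite words all of whose consecutive letters `i j` satisfy `A i j = 1`. -/
structure MarkovWord where
  letters : List 𝒢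
  ne_nil : letters ≠ []
  admissible : letters.IsChain (fun i j => A i j = 1)

variable {A}

/-- The product of `α` and `β` is allowed if `A` is `1` at the last letter of `α` and the first
letter of `β`. -/
def MarkovWord.Composable (α β : MarkovWord A) : Prop :=
  A (α.letters.getLast α.ne_nil) (β.letters.head β.ne_nil) = 1

/-- Concatenation of words. -/
def MarkovWord.comp (α β : MarkovWord A) (h : α.Composable β) : MarkovWord A where
  letters := α.letters ++ β.letters
  ne_nil := by simp [α.ne_nil]
  admissible := by
    refine α.admissible.append β.admissible ?_
    intro x hx y hy
    rw [List.getLast?_eq_some_getLast α.ne_nil] at hx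
    rw [List.head?_eq_some_head β.ne_nil] at hy
    simp only [Option.mem_def, Option.some.injEq] at hx hy
    subst hx hy
    exact h

theorem MarkovWord.comp_composable_iff {α β γ : MarkovWord A} (h : α.Composable β) :
    (α.comp β h).Composable γ ↔ β.Composable γ := by
  simp [Composable, comp, β.ne_nil]

theorem MarkovWord.composable_comp_iff {α β γ : MarkovWord A} (h : β.Composable γ) :
    α.Composable (β.comp γ h) ↔ α.Composable β := by
  simp [Composable, comp, List.head_append_of_ne_nil, β.ne_nil]

variable (A)

/-- The Markov semigroupoid `Λ_A`. -/
instance markovSemigroupoid : Semigroupoid (MarkovWord A) where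
  Composable := MarkovWord.Composable
  comp := MarkovWord.comp
  assoc_basic f g h hfg hgh :=
    ⟨(MarkovWord.comp_composable_iff hfg).2 hgh, (MarkovWord.composable_comp_iff hgh).2 hfg, by
      simp [MarkovWord.comp]⟩
  assoc_left f g h hfg h₁ :=
    ⟨(MarkovWord.comp_composable_iff hfg).1 h₁, (MarkovWord.composable_comp_iff _).2 hfg, by
      simp [MarkovWord.comp]⟩
  assoc_right f g h hgh h₂ :=
    ⟨(MarkovWord.composable_comp_iff hgh).1 h₂, (MarkovWord.comp_composable_iff _).2 hgh, by
      simp [MarkovWord.comp]⟩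

/-! ### The unital Cuntz-Krieger algebra of a 0-1 matrix -/

/-- `A(X,Y,j) = ∏_{x ∈ X} A(x,j) ∏_{y ∈ Y} (1 - A(y,j))`. -/
def matrixEntryProd (X Y : Finset 𝒢) (j : 𝒢) : ℤ :=
  (∏ x ∈ X, A x j) * ∏ y ∈ Y, (1 - A y j)

variable {B : Type v} [CStarAlgebra B]

/-- A Toeplitz-Cuntz-Krieger family for `A`. -/
structure IsToeplitzCuntzKriegerFamily (S : 𝒢 → B) : Prop where
  isPartialIsometry : ∀ i, IsPartialIsometry (S i)
  commute_ini : ∀ i j, Commute (iniProj (S i)) (iniProj (S j))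
  star_mul : ∀ i j, i ≠ j → star (S i) * S j = 0
  ini_mul : ∀ i j, iniProj (S i) * S j = A i j • S j

variable {A}

theorem IsToeplitzCuntzKriegerFamily.commute_one_sub_ini {S : 𝒢 → B}
    (hS : IsToeplitzCuntzKriegerFamily A S) (i j : 𝒢) :
    Commute (1 - iniProj (S i)) (1 - iniProj (S j)) :=
  (Commute.one_left _).sub_left ((Commute.one_right _).sub_right (hS.commute_ini i j))

variable (A)

/-- An Exel-Laca Cuntz-Krieger family for `A`: a Toeplitz-Cuntz-Krieger family that satisfies in
addition `∏_{x ∈ X} Q_x ∏_{y ∈ Y} (1 - Q_y) = ∑_j A(X,Y,j) P_j` for all finite sets `X`, `Y` for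
which only finitely many of the `A(X,Y,j)` are nonzero. -/
structure IsCuntzKriegerFamily (S : 𝒢 → B) : Prop extends IsToeplitzCuntzKriegerFamily A S where
  prod_ini : ∀ (X Y : Finset 𝒢) (hfin : {j | matrixEntryProd A X Y j ≠ 0}.Finite),
    X.noncommProd (fun x => iniProj (S x))
        (fun i _ j _ _ => toIsToeplitzCuntzKriegerFamily.commute_ini i j) *
      Y.noncommProd (fun y => 1 - iniProj (S y))
        (fun i _ j _ _ => toIsToeplitzCuntzKriegerFamily.commute_one_sub_ini i j) =
      ∑ j ∈ hfin.toFinset, matrixEntryProd A X Y j • finProj (S j)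

/-- The defining relations of the unital Cuntz-Krieger algebra. -/
def cuntzKriegerRelations : PartialIsometryRelations 𝒢 where
  Holds _ _ S := IsCuntzKriegerFamily A S
  isPartialIsometry _ _ _ h := h.isPartialIsometry

/-- The unital Cuntz-Krieger algebra of `A`. -/
abbrev UnitalCuntzKriegerAlgebra : Type (u + 1) := (cuntzKriegerRelations A).Universal

end Markov

end

/-!
Both algebras are generated by the partial isometries attached to the letters, so it suffices to
match their models: a representation `S` of the Markov semigroupoid is tight if and only if its
restriction to the letters is a Cuntz–Krieger family, and every Cuntz–Krieger family extends to
words by `S_α = S_{α₁} ⋯ S_{αₙ}`.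

Two projections are equal once they annihilate the same elements. In this form both the tightness
relations and the Cuntz–Krieger relations say that `∏ Q_f ∏ (1 - Q_g)` annihilates `x` as soon as
all `S_h*` with `h` in a covering do. For words a finite covering `H` may contain long elements, but
a word `α` that no element of `H` divides can be extended by only finitely many letters `j`, so that
`Q_α = ∑ P_j` over these letters; descending through the finite tree of prefixes of elements of `H`
shows that `S_α* x = 0`.
-/

/-! ### Commuting projections -/

section Projections

theorem mul_mul_eq_self_iff_of_commute {M : Type*} [Semigroup M] {p q : M}
    (hp : IsIdempotentElem p) (hq : IsIdempotentElem q) (hpq : Commute p q) (x : M) :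
    p * q * x = x ↔ p * x = x ∧ q * x = x := by
  refine ⟨fun h => ⟨?_, ?_⟩, fun ⟨h₁, h₂⟩ => by rw [mul_assoc, h₂, h₁]⟩
  · rw [← h, ← mul_assoc, ← mul_assoc, hp.eq]
  · rw [← h, hpq.eq, ← mul_assoc, ← mul_assoc, hq.eq]

variable {R : Type*} [Ring R]

theorem one_sub_mul_eq_zero_iff {p x : R} : (1 - p) * x = 0 ↔ p * x = x := by
  rw [sub_mul, one_mul, sub_eq_zero, eq_comm]

theorem one_sub_mul_eq_self_iff {p x : R} : (1 - p) * x = x ↔ p * x = 0 := by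
  rw [sub_mul, one_mul, sub_eq_self]

variable {ι : Type*} {p q : ι → R}

/-- The projection `∏_{i ∈ X} q_i ∏_{j ∈ Y} (1 - q_j)` of a commuting family of projections: the
common shape of the right-hand side of the tightness relations and of the left-hand side of the
Cuntz–Krieger relations. -/
def meetProj (q : ι → R) (hq : ∀ i j, Commute (q i) (q j)) (X Y : Finset ι) : R :=
  X.noncommProd q (fun i _ j _ _ => hq i j) *
    Y.noncommProd (fun i => 1 - q i) (fun i _ j _ _ =>
      (Commute.one_left _).sub_left ((Commute.one_right _).sub_right (hq i j)))

theorem meetProj_singleton_empty (hq : ∀ i j, Commute (q i) (q j)) (i : ι) :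
    meetProj q hq {i} ∅ = q i :=
  (congrArg₂ (· * ·) (Finset.noncommProd_singleton i q) (Finset.noncommProd_empty _ _)).trans
    (mul_one _)

theorem commute_noncommProd_noncommProd_one_sub (hq : ∀ i j, Commute (q i) (q j)) (X Y : Finset ι)
    (commX) (commY) :
    Commute (X.noncommProd q commX) (Y.noncommProd (fun i => 1 - q i) commY) :=
  Finset.noncommProd_commute _ _ _ _ fun j _ => (Commute.one_right _).sub_right
    (Finset.noncommProd_commute _ _ _ _ fun i _ => hq j i).symm

variable [StarRing R]

theorem isStarProjection_eq_iff_mul_eq_zero {p q : R} (hp : IsStarProjection p)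
    (hq : IsStarProjection q) : p = q ↔ ∀ x, p * x = 0 ↔ q * x = 0 := by
  refine ⟨fun h x => by rw [h], fun h => ?_⟩
  have hpq : p * q = p := by
    simpa [mul_sub, sub_eq_zero, eq_comm] using (h (1 - q)).2 hq.mul_one_sub_self
  have hqp : q * p = q := by
    simpa [mul_sub, sub_eq_zero, eq_comm] using (h (1 - p)).1 hp.mul_one_sub_self
  have hqp' : q * p = p := by
    simpa [hp.isSelfAdjoint.star_eq, hq.isSelfAdjoint.star_eq] using congrArg star hpq
  exact hqp'.symm.trans hqp

theorem isStarProjection_eq_iff_mul_eq_self {p q : R} (hp : IsStarProjection p)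
    (hq : IsStarProjection q) : p = q ↔ ∀ x, p * x = x ↔ q * x = x := by
  simp only [← one_sub_mul_eq_zero_iff]
  rw [← isStarProjection_eq_iff_mul_eq_zero hp.one_sub hq.one_sub, sub_right_inj]

theorem isStarProjection_noncommProd (hp : ∀ i, IsStarProjection (p i)) (s : Finset ι) (comm) :
    IsStarProjection (s.noncommProd p comm) := by
  induction s using Finset.cons_induction with
  | empty => exact .one R
  | cons i s hi ih =>
    rw [Finset.noncommProd_cons]
    refine (hp i).mul (ih _) (Finset.noncommProd_commute _ _ _ _ fun j hj => ?_)
    exact comm (Finset.mem_cons_self i s) (Finset.mem_cons_of_mem hj)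
      (ne_of_mem_of_not_mem hj hi).symm

theorem noncommProd_mul_eq_self_iff (hp : ∀ i, IsStarProjection (p i)) (s : Finset ι) (comm)
    (x : R) : s.noncommProd p comm * x = x ↔ ∀ i ∈ s, p i * x = x := by
  induction s using Finset.cons_induction with
  | empty => simp
  | cons i s hi ih =>
    have hcomm : Commute (p i) (s.noncommProd p (comm.mono fun _ => Finset.mem_cons_of_mem)) :=
      Finset.noncommProd_commute _ _ _ _ fun j hj =>
        comm (Finset.mem_cons_self i s) (Finset.mem_cons_of_mem hj)
          (ne_of_mem_of_not_mem hj hi).symm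
    rw [Finset.noncommProd_cons, mul_mul_eq_self_iff_of_commute (hp i).isIdempotentElem
      (isStarProjection_noncommProd hp s _).isIdempotentElem hcomm, ih, Finset.forall_mem_cons]

theorem one_sub_noncommProd_one_sub_eq_iff (hp : ∀ i, IsStarProjection (p i)) (s : Finset ι) (comm)
    {e : R} (he : IsStarProjection e) :
    1 - s.noncommProd (fun i => 1 - p i) comm = e ↔
      ∀ x, e * x = 0 ↔ ∀ i ∈ s, p i * x = 0 := by
  have hp' := fun i => (hp i).one_sub
  have hprod := isStarProjection_noncommProd hp' s comm
  rw [eq_comm, isStarProjection_eq_iff_mul_eq_zero he hprod.one_sub]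
  simp only [one_sub_mul_eq_zero_iff, noncommProd_mul_eq_self_iff hp', one_sub_mul_eq_self_iff]

theorem isStarProjection_sum (hp : ∀ i, IsStarProjection (p i))
    (horth : Pairwise fun i j => p i * p j = 0) (s : Finset ι) :
    IsStarProjection (∑ i ∈ s, p i) := by
  induction s using Finset.cons_induction with
  | empty => exact .zero R
  | cons i s hi ih =>
    rw [Finset.sum_cons]
    refine (hp i).add ih ?_
    rw [Finset.mul_sum]
    exact Finset.sum_eq_zero fun j hj => horth (ne_of_mem_of_not_mem hj hi).symm

theorem eq_sum_iff_mul_eq_zero (hp : ∀ i, IsStarProjection (p i))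
    (horth : Pairwise fun i j => p i * p j = 0) (s : Finset ι) {e : R} (he : IsStarProjection e) :
    e = ∑ i ∈ s, p i ↔ ∀ x, e * x = 0 ↔ ∀ i ∈ s, p i * x = 0 := by
  rw [isStarProjection_eq_iff_mul_eq_zero he (isStarProjection_sum hp horth s)]
  refine forall_congr' fun x => iff_congr Iff.rfl ⟨fun h i hi => ?_, fun h => ?_⟩
  · have hpi : p i * ∑ j ∈ s, p j = p i := by
      rw [Finset.mul_sum, Finset.sum_eq_single_of_mem i hi fun j _ hj => horth hj.symm,
        (hp i).isIdempotentElem.eq]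
    rw [← hpi, mul_assoc, h, mul_zero]
  · rw [Finset.sum_mul, Finset.sum_eq_zero h]

theorem isStarProjection_meetProj (hq : ∀ i, IsStarProjection (q i))
    (comm : ∀ i j, Commute (q i) (q j)) (X Y : Finset ι) :
    IsStarProjection (meetProj q comm X Y) :=
  (isStarProjection_noncommProd hq X _).mul
    (isStarProjection_noncommProd (fun i => (hq i).one_sub) Y _)
    (commute_noncommProd_noncommProd_one_sub comm X Y _ _)

theorem meetProj_mul_eq_self_iff (hq : ∀ i, IsStarProjection (q i))
    (comm : ∀ i j, Commute (q i) (q j)) (X Y : Finset ι) (x : R) :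
    meetProj q comm X Y * x = x ↔ (∀ i ∈ X, q i * x = x) ∧ ∀ i ∈ Y, q i * x = 0 := by
  have hq' := fun i => (hq i).one_sub
  refine (mul_mul_eq_self_iff_of_commute
    (isStarProjection_noncommProd hq X _).isIdempotentElem
    (isStarProjection_noncommProd hq' Y _).isIdempotentElem
    (commute_noncommProd_noncommProd_one_sub comm X Y _ _) x).trans
      (and_congr (noncommProd_mul_eq_self_iff hq X _ x)
        ((noncommProd_mul_eq_self_iff hq' Y _ x).trans ?_))
  simp only [one_sub_mul_eq_self_iff]

theorem meetProj_eq_zero_of_eq_one (hq : ∀ i, IsStarProjection (q i))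
    (comm : ∀ i j, Commute (q i) (q j)) (X : Finset ι) {Y : Finset ι} {i : ι} (hi : i ∈ Y)
    (hqi : q i = 1) : meetProj q comm X Y = 0 := by
  have h := (meetProj_mul_eq_self_iff hq comm X Y _).1
    (isStarProjection_meetProj hq comm X Y).isIdempotentElem
  rw [← one_mul (meetProj q comm X Y), ← hqi, h.2 i hi]

end Projections

/-! ### Partial isometries -/

section PartialIsometry

variable {B : Type v} [CStarAlgebra B] {s : B}

namespace IsPartialIsometry

theorem mul_iniProj (hs : IsPartialIsometry s) : s * iniProj s = s := by
  rw [iniProj, ← mul_assoc, hs]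

theorem finProj_mul (hs : IsPartialIsometry s) : finProj s * s = s := hs

theorem isStarProjection_iniProj (hs : IsPartialIsometry s) : IsStarProjection (iniProj s) where
  isIdempotentElem := by
    rw [IsIdempotentElem, iniProj, mul_assoc, ← mul_assoc s, hs]
  isSelfAdjoint := .star_mul_self s

theorem isStarProjection_finProj (hs : IsPartialIsometry s) : IsStarProjection (finProj s) where
  isIdempotentElem := by rw [IsIdempotentElem, finProj, ← mul_assoc, hs]
  isSelfAdjoint := .mul_star_self s

theorem star_mul_finProj (hs : IsPartialIsometry s) : star s * finProj s = star s := by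
  have h := congrArg star hs.finProj_mul
  rwa [star_mul, hs.isStarProjection_finProj.isSelfAdjoint.star_eq] at h

theorem finProj_mul_eq_zero_iff (hs : IsPartialIsometry s) {x : B} :
    finProj s * x = 0 ↔ star s * x = 0 := by
  refine ⟨fun h => ?_, fun h => by rw [finProj, mul_assoc, h, mul_zero]⟩
  rw [← hs.star_mul_finProj, mul_assoc, h, mul_zero]

theorem finProj_mul_finProj_mul (hs : IsPartialIsometry s) (t : B) :
    finProj s * finProj (s * t) = finProj (s * t) := by
  rw [finProj.eq_1 (s * t), ← mul_assoc, ← mul_assoc, hs.finProj_mul]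

theorem commute_finProj_finProj_mul (hs : IsPartialIsometry s) (t : B) :
    Commute (finProj s) (finProj (s * t)) :=
  IsSelfAdjoint.commute_of_mul_eq_isSelfAdjoint _ _ _ (.mul_star_self s) (.mul_star_self (s * t))
    (.mul_star_self (s * t)) (hs.finProj_mul_finProj_mul t)

end IsPartialIsometry

theorem finProj_mul_finProj_eq_zero {t : B} (h : star s * t = 0) : finProj s * finProj t = 0 := by
  rw [finProj, finProj, mul_assoc, ← mul_assoc (star s), h, zero_mul, mul_zero]

theorem star_mul_eq_zero_of_mul_eq_self {e x : B} (he : IsSelfAdjoint e) (hes : e * s = s)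
    (hx : e * x = 0) : star s * x = 0 := by
  rw [← hes, star_mul, he.star_eq, mul_assoc, hx, mul_zero]

end PartialIsometry

/-! ### Representations of semigroupoids -/

namespace Semigroupoid

variable {Λ : Type u} [Semigroupoid Λ] {B : Type v} [CStarAlgebra B] {S : Λ → B}

theorem Divides.refl (f : Λ) : Divides f f := Or.inl rfl

theorem Divides.trans {f g k : Λ} (hfg : Divides f g) (hgk : Divides g k) : Divides f k := by
  obtain rfl | ⟨a, hfa, rfl⟩ := hfg
  · exact hgk
  obtain rfl | ⟨b, hab, rfl⟩ := hgk
  · exact Or.inr ⟨a, hfa, rfl⟩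
  · obtain ⟨h, hf, heq⟩ := assoc_left f a b hfa hab
    exact Or.inr ⟨comp a b h, hf, heq.symm⟩

namespace IsRepresentation

theorem isStarProjection_iniExt (hS : IsRepresentation S) :
    ∀ f : Option Λ, IsStarProjection (iniExt S f)
  | none => .one B
  | some f => (hS.isPartialIsometry f).isStarProjection_iniProj

theorem iniProj_mul_of_composable (hS : IsRepresentation S) {f g : Λ} (h : Composable f g) :
    iniProj (S f) * S g = S g := by
  conv_lhs => rw [← (hS.isPartialIsometry g).finProj_mul, ← mul_assoc, hS.ini_mul_fin f g h]
  exact (hS.isPartialIsometry g).finProj_mul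

theorem iniProj_mul_of_not_composable (hS : IsRepresentation S) {f g : Λ} (h : ¬ Composable f g) :
    iniProj (S f) * S g = 0 := by
  rw [iniProj, mul_assoc, hS.mul_of_not_composable f g h, mul_zero]

theorem iniProj_comp (hS : IsRepresentation S) {f g : Λ} (h : Composable f g) :
    iniProj (S (comp f g h)) = iniProj (S g) := by
  rw [iniProj, ← hS.mul_of_composable, star_mul, mul_assoc, ← mul_assoc (star (S f)), ← iniProj,
    hS.iniProj_mul_of_composable h, ← iniProj]

theorem star_mul_eq_zero_of_divides (hS : IsRepresentation S) {f g : Λ} (h : Divides f g) {x : B}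
    (hx : star (S f) * x = 0) : star (S g) * x = 0 := by
  obtain rfl | ⟨k, hk, rfl⟩ := h
  · exact hx
  · rw [← hS.mul_of_composable, star_mul, mul_assoc, hx, mul_zero]

theorem meetProj_iniExt_mul (hS : IsRepresentation S) {F G : Finset (Option Λ)} {h : Λ}
    (hh : h ∈ domainSet F G) : meetProj (iniExt S) hS.commute_iniExt F G * S h = S h := by
  refine (meetProj_mul_eq_self_iff hS.isStarProjection_iniExt _ _ _ _).2 ⟨?_, ?_⟩
  · rintro (_ | f) hf
    · exact one_mul _
    · exact hS.iniProj_mul_of_composable (hh.1 _ hf)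
  · rintro (_ | g) hg
    · exact absurd trivial (hh.2 _ hg)
    · exact hS.iniProj_mul_of_not_composable (hh.2 _ hg)

theorem isTight_iff (hS : IsRepresentation S) :
    IsTight S ↔ ∀ (F G : Finset (Option Λ)) (H : Finset Λ),
      IsCovering (H : Set Λ) (domainSet F G) → ∀ x : B, (∀ h ∈ H, star (S h) * x = 0) →
        meetProj (iniExt S) hS.commute_iniExt F G * x = 0 := by
  have key (F G : Finset (Option Λ)) (H : Finset Λ) :=
    one_sub_noncommProd_one_sub_eq_iff (fun h => (hS.isPartialIsometry h).isStarProjection_finProj)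
      H (fun f _ g _ _ => hS.commute_one_sub_fin f g)
      (isStarProjection_meetProj hS.isStarProjection_iniExt hS.commute_iniExt F G)
  simp only [(hS.isPartialIsometry _).finProj_mul_eq_zero_iff] at key
  refine ⟨fun ht F G H hH x => ((key F G H).1 (ht.tight F G H hH) x).2,
    fun ht => ⟨hS, fun F G H hH => (key F G H).2 fun x => ⟨fun hx h hh => ?_, ht F G H hH x⟩⟩⟩
  exact star_mul_eq_zero_of_mul_eq_self
    (isStarProjection_meetProj hS.isStarProjection_iniExt _ F G).isSelfAdjoint
    (hS.meetProj_iniExt_mul (hH.1 hh)) hx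

end IsRepresentation

end Semigroupoid

/-! ### Markov words -/

namespace MarkovWord

open Semigroupoid

variable {𝒢 : Type u} {A : Matrix 𝒢 𝒢 ℤ}

attribute [ext] MarkovWord

/-- The first letter of a word, on which composability with the words to the left depends. -/
def first (α : MarkovWord A) : 𝒢 := α.letters.head α.ne_nil

/-- The last letter of a word, on which composability with the words to the right depends. -/
def last (α : MarkovWord A) : 𝒢 := α.letters.getLast α.ne_nil

/-- A letter as a word of length one; these words generate the Markov semigroupoid. -/
def single (i : 𝒢) : MarkovWord A := ⟨[i], by simp, by simp⟩

theorem composable_iff {α β : MarkovWord A} :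
    Semigroupoid.Composable α β ↔ A α.last β.first = 1 :=
  Iff.rfl

@[simp] theorem last_single (i : 𝒢) : (single i : MarkovWord A).last = i := rfl

@[simp] theorem letters_single (i : 𝒢) : (single i : MarkovWord A).letters = [i] := rfl

@[simp] theorem letters_comp {α β : MarkovWord A} (h : Semigroupoid.Composable α β) :
    (Semigroupoid.comp α β h).letters = α.letters ++ β.letters := rfl

@[simp] theorem first_comp {α β : MarkovWord A} (h : Semigroupoid.Composable α β) :
    (Semigroupoid.comp α β h).first = α.first := by
  simp [first, List.head_append_of_ne_nil, α.ne_nil]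

@[simp] theorem last_comp {α β : MarkovWord A} (h : Semigroupoid.Composable α β) :
    (Semigroupoid.comp α β h).last = β.last := by
  simp [last, β.ne_nil]

@[elab_as_elim]
theorem induction {P : MarkovWord A → Prop} (single : ∀ i, P (single i))
    (single_comp : ∀ (i : 𝒢) (α : MarkovWord A)
      (h : Semigroupoid.Composable (MarkovWord.single i) α),
      P α → P (Semigroupoid.comp (MarkovWord.single i) α h))
    (α : MarkovWord A) : P α := by
  obtain ⟨l, hne, hl⟩ := α
  induction l with
  | nil => exact absurd rfl hne
  | cons i l ih =>
    cases l with
    | nil => exact single i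
    | cons j l =>
      have hl' := List.isChain_cons_cons.1 hl
      exact single_comp i ⟨j :: l, List.cons_ne_nil j l, hl'.2⟩ hl'.1 (ih _ hl'.2)

theorem divides_iff {α β : MarkovWord A} : Divides α β ↔ α.letters <+: β.letters := by
  constructor
  · rintro (rfl | ⟨γ, h, rfl⟩)
    · exact List.prefix_rfl
    · exact List.prefix_append _ _
  · rintro ⟨l, hl⟩
    obtain rfl | hne := eq_or_ne l []
    · exact Or.inl (MarkovWord.ext ((List.append_nil _).symm.trans hl))
    · obtain ⟨-, hlchain, hjoin⟩ := List.isChain_append.1 (hl ▸ β.admissible)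
      exact Or.inr ⟨⟨l, hne, hlchain⟩, hjoin _ (List.getLast?_eq_some_getLast α.ne_nil) _
        (List.head?_eq_some_head hne), MarkovWord.ext hl⟩

theorem intersects_iff {α β : MarkovWord A} : Intersects α β ↔ Divides α β ∨ Divides β α := by
  constructor
  · rintro ⟨γ, hα, hβ⟩
    rw [divides_iff] at *
    rw [divides_iff]
    exact List.prefix_or_prefix_of_prefix hα hβ
  · rintro (h | h)
    · exact ⟨β, h, .refl β⟩
    · exact ⟨α, .refl α, h⟩

theorem first_eq_of_divides {α β : MarkovWord A} (h : Divides α β) : α.first = β.first := by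
  obtain rfl | ⟨γ, h, rfl⟩ := h
  · rfl
  · rw [first_comp]

theorem first_eq_of_intersects {α β : MarkovWord A} (h : Intersects α β) : α.first = β.first :=
  let ⟨_, hα, hβ⟩ := h
  (first_eq_of_divides hα).trans (first_eq_of_divides hβ).symm

theorem single_first_divides (α : MarkovWord A) : Divides (single α.first) α :=
  divides_iff.2 ⟨α.letters.tail, List.cons_head_tail α.ne_nil⟩

theorem divides_comp_single_iff {α β : MarkovWord A} {j : 𝒢}
    (h : Semigroupoid.Composable β (single j)) :
    Divides α (Semigroupoid.comp β (single j) h) ↔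
      α = Semigroupoid.comp β (single j) h ∨ Divides α β := by
  simp only [divides_iff, MarkovWord.ext_iff, letters_comp, letters_single, List.prefix_concat_iff]

theorem getElem?_of_comp_single_divides {α β : MarkovWord A} {j : 𝒢}
    {h : Semigroupoid.Composable α (single j)}
    (hβ : Divides (Semigroupoid.comp α (single j) h) β) :
    β.letters[α.letters.length]? = some j := by
  obtain ⟨l, hl⟩ := divides_iff.1 hβ
  simp [← hl]

theorem finite_extensions_of_forall_intersects {H : Set (MarkovWord A)} (hH : H.Finite)
    {α : MarkovWord A} (hα : ∀ h ∈ H, ¬ Divides h α)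
    (hcov : ∀ β, Divides α β → ∃ h ∈ H, Intersects h β) : {j | A α.last j = 1}.Finite := by
  refine ((hH.image fun h => h.letters[α.letters.length]?).preimage
    (Option.some_injective 𝒢).injOn).subset fun j hj => ?_
  obtain ⟨h, hh, hint⟩ := hcov (Semigroupoid.comp α (single j) hj) (Or.inr ⟨_, hj, rfl⟩)
  refine ⟨h, hh, getElem?_of_comp_single_divides (h := hj) ?_⟩
  obtain hdiv | hdiv := intersects_iff.1 hint
  · obtain rfl | hdiv := (divides_comp_single_iff _).1 hdiv
    · exact .refl _
    · exact absurd hdiv (hα h hh)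
  · exact hdiv

open Classical in
/-- The last letters of the words in a finite subset of the unitization. For a representation `S`
of the Markov semigroupoid `Q_α` depends only on the last letter of `α`, so `lastLetters` turns the
index sets of the tightness relations into those of the Cuntz–Krieger relations. -/
noncomputable def lastLetters (F : Finset (Option (MarkovWord A))) : Finset 𝒢 :=
  F.eraseNone.image last

theorem mem_lastLetters {F : Finset (Option (MarkovWord A))} {i : 𝒢} :
    i ∈ lastLetters F ↔ ∃ α : MarkovWord A, some α ∈ F ∧ α.last = i := by
  simp [lastLetters]

open Classical in
/-- A finite set of letters as a finite subset of the unitization of the Markov semigroupoid: a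
section of `lastLetters`. -/
noncomputable def singles (X : Finset 𝒢) : Finset (Option (MarkovWord A)) :=
  X.image fun i => some (single i)

theorem none_notMem_singles (X : Finset 𝒢) :
    none ∉ (singles X : Finset (Option (MarkovWord A))) := by
  simp [singles]

theorem lastLetters_singles (X : Finset 𝒢) :
    lastLetters (singles X : Finset (Option (MarkovWord A))) = X := by
  ext i
  simp [mem_lastLetters, singles]

end MarkovWord

section MatrixEntryProd

variable {𝒢 : Type u} {A : Matrix 𝒢 𝒢 ℤ}

theorem matrixEntryProd_ne_zero_iff (hA : ∀ i j, A i j = 0 ∨ A i j = 1) {X Y : Finset 𝒢} {j : 𝒢} :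
    matrixEntryProd A X Y j ≠ 0 ↔ (∀ x ∈ X, A x j = 1) ∧ ∀ y ∈ Y, A y j = 0 := by
  rw [matrixEntryProd, mul_ne_zero_iff, Finset.prod_ne_zero_iff, Finset.prod_ne_zero_iff]
  refine and_congr (forall₂_congr fun i _ => ?_) (forall₂_congr fun i _ => ?_) <;>
    obtain h | h := hA i j <;> simp [h]

theorem matrixEntryProd_eq_one (hA : ∀ i j, A i j = 0 ∨ A i j = 1) {X Y : Finset 𝒢} {j : 𝒢}
    (h : matrixEntryProd A X Y j ≠ 0) : matrixEntryProd A X Y j = 1 := by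
  obtain ⟨hX, hY⟩ := (matrixEntryProd_ne_zero_iff hA).1 h
  rw [matrixEntryProd, Finset.prod_eq_one hX,
    Finset.prod_eq_one fun y hy => by rw [hY y hy, sub_zero], one_mul]

theorem MarkovWord.mem_domainSet_iff (hA : ∀ i j, A i j = 0 ∨ A i j = 1)
    {F G : Finset (Option (MarkovWord A))} (hG : none ∉ G) {β : MarkovWord A} :
    β ∈ Semigroupoid.domainSet F G ↔
      matrixEntryProd A (lastLetters F) (lastLetters G) β.first ≠ 0 := by
  have not_composable_iff (α : MarkovWord A) :
      ¬ Semigroupoid.Composable α β ↔ A α.last β.first = 0 := by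
    rw [composable_iff]
    obtain h | h := hA α.last β.first <;> simp [h]
  rw [matrixEntryProd_ne_zero_iff hA]
  simp only [mem_lastLetters, forall_exists_index, and_imp, forall_apply_eq_imp_iff₂]
  refine and_congr ⟨fun h α hα => h _ hα, fun h f hf => ?_⟩
    ⟨fun h α hα => (not_composable_iff α).1 (h _ hα), fun h g hg => ?_⟩
  · cases f with
    | none => trivial
    | some α => exact h α hf
  · cases g with
    | none => exact absurd hg hG
    | some α => exact (not_composable_iff α).2 (h α hg)

end MatrixEntryProd

/-! ### Products over words -/

section WordProd

variable {𝒢 : Type u} {A : Matrix 𝒢 𝒢 ℤ}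

namespace MarkovWord

variable {M : Type*} [Monoid M]

/-- The element `S_α = S_{α₁} ⋯ S_{αₙ}` attached to the word `α = α₁ ⋯ αₙ`, by which a
Cuntz–Krieger family extends to a representation of the Markov semigroupoid. -/
def wordProd (S : 𝒢 → M) (α : MarkovWord A) : M := (α.letters.map S).prod

theorem wordProd_single (S : 𝒢 → M) (i : 𝒢) : wordProd S (single i : MarkovWord A) = S i :=
  List.prod_singleton

theorem wordProd_comp (S : 𝒢 → M) {α β : MarkovWord A} (h : Semigroupoid.Composable α β) :
    wordProd S (Semigroupoid.comp α β h) = wordProd S α * wordProd S β := by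
  rw [wordProd, letters_comp, List.map_append, List.prod_append, wordProd, wordProd]

theorem map_wordProd {N F : Type*} [Monoid N] [FunLike F M N] [MonoidHomClass F M N] (φ : F)
    (S : 𝒢 → M) (α : MarkovWord A) : φ (wordProd S α) = wordProd (fun i => φ (S i)) α := by
  rw [wordProd, map_list_prod, List.map_map]
  rfl

end MarkovWord

open MarkovWord

namespace IsToeplitzCuntzKriegerFamily

variable {B : Type v} [CStarAlgebra B] {S : 𝒢 → B}

theorem iniProj_mul_prod (hS : IsToeplitzCuntzKriegerFamily A S) (i : 𝒢) {l : List 𝒢} (h : l ≠ []) :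
    iniProj (S i) * (l.map S).prod = A i (l.head h) • (l.map S).prod := by
  cases l with
  | nil => exact absurd rfl h
  | cons j l => rw [List.map_cons, List.prod_cons, ← mul_assoc, hS.ini_mul, smul_mul_assoc,
      List.head_cons]

theorem star_prod_mul_prod_of_not_prefix (hS : IsToeplitzCuntzKriegerFamily A S) :
    ∀ l m : List 𝒢, ¬ l <+: m → ¬ m <+: l → star (l.map S).prod * (m.map S).prod = 0
  | [], _, h, _ => absurd List.nil_prefix h
  | _, [], _, h => absurd List.nil_prefix h
  | i :: l, j :: m, hlm, hml => by
    rw [List.map_cons, List.prod_cons, StarMul.star_mul, List.map_cons, List.prod_cons, mul_assoc,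
      ← mul_assoc (star (S i))]
    obtain rfl | hij := eq_or_ne i j
    · rw [List.prefix_cons_inj] at hlm hml
      have hm : m ≠ [] := fun h => hml (h ▸ List.nil_prefix)
      rw [← iniProj, hS.iniProj_mul_prod i hm, mul_smul_comm,
        star_prod_mul_prod_of_not_prefix hS l m hlm hml, smul_zero]
    · rw [hS.star_mul i j hij, zero_mul, mul_zero]

theorem iniProj_mul_wordProd (hS : IsToeplitzCuntzKriegerFamily A S) (i : 𝒢) (α : MarkovWord A) :
    iniProj (S i) * wordProd S α = A i α.first • wordProd S α :=
  hS.iniProj_mul_prod i α.ne_nil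

theorem iniProj_wordProd (hS : IsToeplitzCuntzKriegerFamily A S) (α : MarkovWord A) :
    iniProj (wordProd S α) = iniProj (S α.last) := by
  induction α using MarkovWord.induction with
  | single i => rw [wordProd_single, last_single]
  | single_comp i α h ih =>
    have hα : iniProj (S i) * wordProd S α = wordProd S α := by
      rw [hS.iniProj_mul_wordProd, show A i α.first = 1 from h, one_smul]
    rw [wordProd_comp, wordProd_single, last_comp, ← ih, iniProj, StarMul.star_mul, mul_assoc,
      ← mul_assoc (star (S i)), ← iniProj, hα, iniProj]

theorem isPartialIsometry_wordProd (hS : IsToeplitzCuntzKriegerFamily A S) (α : MarkovWord A) :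
    IsPartialIsometry (wordProd S α) := by
  suffices h : wordProd S α * iniProj (S α.last) = wordProd S α by
    rwa [← hS.iniProj_wordProd, iniProj, ← mul_assoc] at h
  induction α using MarkovWord.induction with
  | single i => rw [wordProd_single, last_single, (hS.isPartialIsometry i).mul_iniProj]
  | single_comp i α h ih => rw [wordProd_comp, last_comp, mul_assoc, ih]

theorem wordProd_mul_wordProd_of_not_composable (hS : IsToeplitzCuntzKriegerFamily A S)
    (hA : ∀ i j, A i j = 0 ∨ A i j = 1) {α β : MarkovWord A}
    (h : ¬ Semigroupoid.Composable α β) : wordProd S α * wordProd S β = 0 := by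
  have h₀ : A α.last β.first = 0 := (hA _ _).resolve_right h
  rw [← (hS.isPartialIsometry_wordProd α).mul_iniProj, mul_assoc, hS.iniProj_wordProd,
    hS.iniProj_mul_wordProd, h₀, zero_smul, mul_zero]

theorem iniProj_mul_finProj_wordProd (hS : IsToeplitzCuntzKriegerFamily A S) (i : 𝒢)
    (α : MarkovWord A) :
    iniProj (S i) * finProj (wordProd S α) = A i α.first • finProj (wordProd S α) := by
  rw [finProj, ← mul_assoc, hS.iniProj_mul_wordProd, smul_mul_assoc]

theorem finProj_mul_finProj_of_not_intersects (hS : IsToeplitzCuntzKriegerFamily A S)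
    {α β : MarkovWord A} (h : ¬ Semigroupoid.Intersects α β) :
    finProj (wordProd S α) * finProj (wordProd S β) = 0 := by
  rw [intersects_iff, not_or, divides_iff, divides_iff] at h
  exact finProj_mul_finProj_eq_zero (hS.star_prod_mul_prod_of_not_prefix _ _ h.1 h.2)

theorem commute_finProj_of_divides (hS : IsToeplitzCuntzKriegerFamily A S) {α β : MarkovWord A}
    (h : Semigroupoid.Divides α β) :
    Commute (finProj (wordProd S α)) (finProj (wordProd S β)) := by
  obtain rfl | ⟨γ, h, rfl⟩ := h
  · exact .refl _
  · rw [wordProd_comp]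
    exact (hS.isPartialIsometry_wordProd α).commute_finProj_finProj_mul _

theorem commute_finProj_wordProd (hS : IsToeplitzCuntzKriegerFamily A S) (α β : MarkovWord A) :
    Commute (finProj (wordProd S α)) (finProj (wordProd S β)) := by
  by_cases hαβ : Semigroupoid.Intersects α β
  · exact (intersects_iff.1 hαβ).elim hS.commute_finProj_of_divides
      fun h => (hS.commute_finProj_of_divides h).symm
  · have hβα : ¬ Semigroupoid.Intersects β α := fun ⟨m, hβ, hα⟩ => hαβ ⟨m, hα, hβ⟩
    exact (hS.finProj_mul_finProj_of_not_intersects hαβ).trans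
      (hS.finProj_mul_finProj_of_not_intersects hβα).symm

theorem commute_iniProj_finProj_wordProd (hS : IsToeplitzCuntzKriegerFamily A S) (i : 𝒢)
    (α : MarkovWord A) : Commute (iniProj (S i)) (finProj (wordProd S α)) :=
  IsSelfAdjoint.commute_of_mul_eq_isSelfAdjoint _ _ _ (.star_mul_self _) (.mul_star_self _)
    (.smul (.all _) (.mul_star_self _)) (hS.iniProj_mul_finProj_wordProd i α)

theorem isRepresentation_wordProd (hS : IsToeplitzCuntzKriegerFamily A S)
    (hA : ∀ i j, A i j = 0 ∨ A i j = 1) :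
    Semigroupoid.IsRepresentation (wordProd S : MarkovWord A → B) where
  isPartialIsometry := hS.isPartialIsometry_wordProd
  mul_of_composable _ _ h := (wordProd_comp S h).symm
  mul_of_not_composable _ _ := hS.wordProd_mul_wordProd_of_not_composable hA
  commute_ini_ini α β := by
    rw [hS.iniProj_wordProd, hS.iniProj_wordProd]
    exact hS.commute_ini _ _
  commute_fin_fin := hS.commute_finProj_wordProd
  commute_ini_fin α β := by
    rw [hS.iniProj_wordProd]
    exact hS.commute_iniProj_finProj_wordProd _ _
  fin_mul_fin_of_disjoint _ _ := hS.finProj_mul_finProj_of_not_intersects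
  ini_mul_fin α β h := by
    rw [hS.iniProj_wordProd, hS.iniProj_mul_finProj_wordProd, composable_iff.1 h, one_smul]

theorem meetProj_iniProj_mul (hS : IsToeplitzCuntzKriegerFamily A S)
    (hA : ∀ i j, A i j = 0 ∨ A i j = 1) {X Y : Finset 𝒢} {j : 𝒢}
    (hj : matrixEntryProd A X Y j ≠ 0) :
    meetProj (fun i => iniProj (S i)) hS.commute_ini X Y * S j = S j := by
  obtain ⟨hX, hY⟩ := (matrixEntryProd_ne_zero_iff hA).1 hj
  refine (meetProj_mul_eq_self_iff
    (fun i => (hS.isPartialIsometry i).isStarProjection_iniProj) _ _ _ _).2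
    ⟨fun i hi => ?_, fun i hi => ?_⟩
  · rw [hS.ini_mul, hX i hi, one_smul]
  · rw [hS.ini_mul, hY i hi, zero_smul]

theorem meetProj_eq_sum_iff (hS : IsToeplitzCuntzKriegerFamily A S)
    (hA : ∀ i j, A i j = 0 ∨ A i j = 1) {X Y : Finset 𝒢}
    (hfin : {j | matrixEntryProd A X Y j ≠ 0}.Finite) :
    meetProj (fun i => iniProj (S i)) hS.commute_ini X Y =
        ∑ j ∈ hfin.toFinset, matrixEntryProd A X Y j • finProj (S j) ↔
      ∀ x : B, (∀ j, matrixEntryProd A X Y j ≠ 0 → star (S j) * x = 0) →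
        meetProj (fun i => iniProj (S i)) hS.commute_ini X Y * x = 0 := by
  have hproj := isStarProjection_meetProj
    (fun i => (hS.isPartialIsometry i).isStarProjection_iniProj) hS.commute_ini X Y
  have hsum : ∑ j ∈ hfin.toFinset, matrixEntryProd A X Y j • finProj (S j) =
      ∑ j ∈ hfin.toFinset, finProj (S j) := Finset.sum_congr rfl fun j hj => by
    rw [matrixEntryProd_eq_one hA (hfin.mem_toFinset.1 hj), one_smul]
  rw [hsum, eq_sum_iff_mul_eq_zero
    (fun i => (hS.isPartialIsometry i).isStarProjection_finProj)
    (fun i j hij => finProj_mul_finProj_eq_zero (hS.star_mul i j hij)) _ hproj]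
  simp only [(hS.isPartialIsometry _).finProj_mul_eq_zero_iff, Set.Finite.mem_toFinset,
    Set.mem_ofPred_eq]
  exact ⟨fun h x => (h x).2, fun h x => ⟨fun hx j hj => star_mul_eq_zero_of_mul_eq_self
    hproj.isSelfAdjoint (hS.meetProj_iniProj_mul hA hj) hx, h x⟩⟩

theorem isCuntzKriegerFamily_iff (hS : IsToeplitzCuntzKriegerFamily A S)
    (hA : ∀ i j, A i j = 0 ∨ A i j = 1) :
    IsCuntzKriegerFamily A S ↔ ∀ X Y : Finset 𝒢, {j | matrixEntryProd A X Y j ≠ 0}.Finite →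
      ∀ x : B, (∀ j, matrixEntryProd A X Y j ≠ 0 → star (S j) * x = 0) →
        meetProj (fun i => iniProj (S i)) hS.commute_ini X Y * x = 0 :=
  ⟨fun h X Y hfin => (hS.meetProj_eq_sum_iff hA hfin).1 (h.prod_ini X Y hfin),
    fun h => ⟨hS, fun X Y hfin => (hS.meetProj_eq_sum_iff hA hfin).2 (h X Y hfin)⟩⟩

end IsToeplitzCuntzKriegerFamily

end WordProd

/-! ### Representations of the Markov semigroupoid -/

namespace Semigroupoid.IsRepresentation

open MarkovWord

variable {𝒢 : Type u} {A : Matrix 𝒢 𝒢 ℤ} {B : Type v} [CStarAlgebra B] {S : MarkovWord A → B}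

theorem wordProd_single (hS : IsRepresentation S) (α : MarkovWord A) :
    wordProd (fun i => S (single i)) α = S α := by
  induction α using MarkovWord.induction with
  | single i => rw [MarkovWord.wordProd_single]
  | single_comp i α h ih =>
    rw [wordProd_comp, ih, MarkovWord.wordProd_single, hS.mul_of_composable]

theorem isToeplitzCuntzKriegerFamily_single (hS : IsRepresentation S)
    (hA : ∀ i j, A i j = 0 ∨ A i j = 1) :
    IsToeplitzCuntzKriegerFamily A fun i => S (single i) where
  isPartialIsometry i := hS.isPartialIsometry _
  commute_ini i j := hS.commute_ini_ini _ _
  star_mul i j hij := by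
    have h : finProj (S (single i)) * finProj (S (single j)) = 0 :=
      hS.fin_mul_fin_of_disjoint _ _ fun h => hij (first_eq_of_intersects h)
    rw [← (hS.isPartialIsometry (single i)).finProj_mul_eq_zero_iff,
      ← (hS.isPartialIsometry (single j)).finProj_mul, ← mul_assoc, h, zero_mul]
  ini_mul i j := by
    obtain h | h := hA i j
    · rw [h, zero_smul, hS.iniProj_mul_of_not_composable]
      exact fun h₁ => zero_ne_one (h.symm.trans h₁)
    · rw [h, one_smul, hS.iniProj_mul_of_composable h]

theorem iniProj_eq_iniProj_last (hS : IsRepresentation S) (α : MarkovWord A) :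
    iniProj (S α) = iniProj (S (single α.last)) := by
  induction α using MarkovWord.induction with
  | single i => rfl
  | single_comp i α h ih => rw [hS.iniProj_comp, ih, last_comp]

theorem meetProj_iniExt_eq (hS : IsRepresentation S) {F G : Finset (Option (MarkovWord A))}
    (hG : none ∉ G) :
    meetProj (iniExt S) hS.commute_iniExt F G =
      meetProj (fun i => iniProj (S (single i))) (fun _ _ => hS.commute_ini_ini _ _)
        (lastLetters F) (lastLetters G) := by
  have hQ (i : 𝒢) := (hS.isPartialIsometry (single i)).isStarProjection_iniProj
  refine (isStarProjection_eq_iff_mul_eq_self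
    (isStarProjection_meetProj hS.isStarProjection_iniExt _ _ _)
    (isStarProjection_meetProj hQ _ _ _)).2 fun x => ?_
  rw [meetProj_mul_eq_self_iff hS.isStarProjection_iniExt, meetProj_mul_eq_self_iff hQ]
  simp only [mem_lastLetters, forall_exists_index, and_imp, forall_apply_eq_imp_iff₂,
    ← hS.iniProj_eq_iniProj_last]
  refine and_congr ⟨fun h α hα => h _ hα, ?_⟩ ⟨fun h α hα => h _ hα, ?_⟩
  · rintro h (_ | α) hα
    · exact one_mul x
    · exact h α hα
  · rintro h (_ | α) hα
    · exact absurd hα hG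
    · exact h α hα

theorem star_mul_eq_zero_of_extensions (hS : IsRepresentation S)
    (hT : IsCuntzKriegerFamily A fun i => S (single i)) (hA : ∀ i j, A i j = 0 ∨ A i j = 1)
    {α : MarkovWord A} (hfin : {j | A α.last j = 1}.Finite) {x : B}
    (hx : ∀ (j : 𝒢) (hj : Composable α (single j)), star (S (comp α (single j) hj)) * x = 0) :
    star (S α) * x = 0 := by
  have hmem (j : 𝒢) : matrixEntryProd A {α.last} ∅ j ≠ 0 ↔ A α.last j = 1 := by
    rw [matrixEntryProd_ne_zero_iff hA]
    simp
  have hQ : iniProj (S (single α.last)) * (star (S α) * x) = 0 := by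
    have h := (hT.isCuntzKriegerFamily_iff hA).1 hT {α.last} ∅ (by simpa only [hmem] using hfin)
      (star (S α) * x) fun j hj => by
        rw [← mul_assoc, ← StarMul.star_mul, hS.mul_of_composable _ _ ((hmem j).1 hj)]
        exact hx j ((hmem j).1 hj)
    rwa [meetProj_singleton_empty] at h
  have hstar : star (S α) = iniProj (S α) * star (S α) := by
    conv_lhs => rw [← (hS.isPartialIsometry α).mul_iniProj, StarMul.star_mul,
      (hS.isPartialIsometry α).isStarProjection_iniProj.isSelfAdjoint.star_eq]
  rw [hstar, mul_assoc, hS.iniProj_eq_iniProj_last, hQ]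

theorem star_mul_eq_zero_of_forall_intersects (hS : IsRepresentation S)
    (hT : IsCuntzKriegerFamily A fun i => S (single i)) (hA : ∀ i j, A i j = 0 ∨ A i j = 1)
    {H : Finset (MarkovWord A)} {x : B} (hx : ∀ h ∈ H, star (S h) * x = 0) {α : MarkovWord A}
    (hcov : ∀ β, Divides α β → ∃ h ∈ H, Intersects h β) : star (S α) * x = 0 := by
  obtain ⟨n, hn⟩ : ∃ n, ∀ h ∈ H, h.letters.length < α.letters.length + n :=
    ⟨H.sup (fun h => h.letters.length) + 1, fun h hh => by
      have := Finset.le_sup (f := fun h : MarkovWord A => h.letters.length) hh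
      omega⟩
  induction n generalizing α with
  | zero =>
    obtain ⟨h, hh, hint⟩ := hcov α (.refl α)
    refine hS.star_mul_eq_zero_of_divides ((intersects_iff.1 hint).resolve_right fun hdiv => ?_)
      (hx h hh)
    exact absurd (divides_iff.1 hdiv).length_le (hn h hh).not_ge
  | succ n ih =>
    by_cases hex : ∃ h ∈ H, Divides h α
    · obtain ⟨h, hh, hdiv⟩ := hex
      exact hS.star_mul_eq_zero_of_divides hdiv (hx h hh)
    push Not at hex
    refine hS.star_mul_eq_zero_of_extensions hT hA
      (finite_extensions_of_forall_intersects H.finite_toSet hex hcov) fun j hj =>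
        ih (α := comp α (single j) hj) ?_ ?_
    · exact fun β hβ => hcov β (.trans (Or.inr ⟨_, hj, rfl⟩) hβ)
    · intro h hh
      have := hn h hh
      rw [letters_comp, List.length_append, letters_single, List.length_singleton]
      omega

theorem isCuntzKriegerFamily_of_isTight (hS : IsTight S) (hA : ∀ i j, A i j = 0 ∨ A i j = 1) :
    IsCuntzKriegerFamily A fun i => S (single i) := by
  classical
  refine ((hS.isToeplitzCuntzKriegerFamily_single hA).isCuntzKriegerFamily_iff hA).2
    fun X Y hfin x hx => ?_
  have hdom (β : MarkovWord A) :
      β ∈ domainSet (singles X) (singles Y) ↔ matrixEntryProd A X Y β.first ≠ 0 := by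
    rw [mem_domainSet_iff hA (none_notMem_singles Y), lastLetters_singles, lastLetters_singles]
  have hcov : IsCovering ((hfin.toFinset.image single : Finset (MarkovWord A)) : Set (MarkovWord A))
      (domainSet (singles X) (singles Y)) := by
    refine ⟨fun h hh => ?_, fun β hβ => ⟨single β.first, ?_, β, single_first_divides β, .refl β⟩⟩
    · obtain ⟨j, hj, rfl⟩ := Finset.mem_image.1 (Finset.mem_coe.1 hh)
      exact (hdom _).2 (hfin.mem_toFinset.1 hj)
    · exact Finset.mem_coe.2 (Finset.mem_image_of_mem _ (hfin.mem_toFinset.2 ((hdom β).1 hβ)))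
  have h := hS.isTight_iff.1 hS _ _ _ hcov x (Finset.forall_mem_image.2 fun j hj =>
    hx j (hfin.mem_toFinset.1 hj))
  simpa only [hS.meetProj_iniExt_eq (none_notMem_singles Y), lastLetters_singles] using h

theorem isTight_of_isCuntzKriegerFamily (hS : IsRepresentation S)
    (hT : IsCuntzKriegerFamily A fun i => S (single i)) (hA : ∀ i j, A i j = 0 ∨ A i j = 1) :
    IsTight S := by
  refine hS.isTight_iff.2 fun F G H hcov x hx => ?_
  by_cases hG : none ∈ G
  · rw [meetProj_eq_zero_of_eq_one hS.isStarProjection_iniExt hS.commute_iniExt F hG rfl, zero_mul]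
  rw [hS.meetProj_iniExt_eq hG]
  refine (hT.isCuntzKriegerFamily_iff hA).1 hT _ _ ?_ x fun j hj =>
    hS.star_mul_eq_zero_of_forall_intersects hT hA hx fun β hβ => hcov.2 β ?_
  · refine (H.finite_toSet.image first).subset fun j hj => ?_
    obtain ⟨h, hh, hint⟩ := hcov.2 (single j) ((mem_domainSet_iff hA hG).2 hj)
    exact ⟨h, hh, first_eq_of_intersects hint⟩
  · rwa [mem_domainSet_iff hA hG, ← first_eq_of_divides hβ]

end Semigroupoid.IsRepresentation

/-! ### Universal C*-algebras -/

namespace PartialIsometryRelations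

open scoped CStarAlgebra

variable {X Y : Type u} {R : PartialIsometryRelations X} {R' : PartialIsometryRelations Y}

/-- The homomorphism from the universal algebra to a model: the coordinate projection of the
product over all models. -/
def Model.eval (M : R.Model) : R.Universal →⋆ₐ[ℂ] M.carrier where
  toFun a := a.1.1 M
  map_one' := rfl
  map_mul' _ _ := rfl
  map_zero' := rfl
  map_add' _ _ := rfl
  commutes' _ := rfl
  map_star' _ := rfl

theorem Model.eval_generator (M : R.Model) (x : X) : M.eval (R.generator x) = M.family x := rfl

theorem universal_ext {a b : R.Universal} (h : ∀ M : R.Model, M.eval a = M.eval b) : a = b :=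
  Subtype.ext (Subtype.ext (funext h))

theorem universal_hom_ext {C : Type v} [CStarAlgebra C] {φ ψ : R.Universal →⋆ₐ[ℂ] C}
    (h : ∀ x, φ (R.generator x) = ψ (R.generator x)) : φ = ψ := by
  have hcont (χ : R.Universal →⋆ₐ[ℂ] C) : Continuous χ :=
    (NonUnitalStarAlgHom.instContinuousLinearMapClassComplex
      (F := R.Universal →⋆ₐ[ℂ] C)).map_continuous χ
  refine StarAlgHom.ext_topologicalClosure (hcont φ) (hcont ψ) (StarAlgHom.ext_adjoin ?_)
  rintro ⟨_, _⟩ ⟨x, rfl⟩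
  exact h x

/-- The homomorphism between the products over all models that restricts functions along a map of
models in the opposite direction: `T` turns every model of `R'` into a model of `R` with the same
underlying algebra. -/
def productMap (T : ∀ N : R'.Model, X → N.carrier) (hT : ∀ N, R.Holds N.carrier (T N)) :
    R.Product →⋆ₐ[ℂ] R'.Product where
  toFun f := (⟨fun N => f.1 ⟨N.carrier, T N, hT N⟩,
    memℓp_infty (f.2.bddAbove.mono (by rintro _ ⟨N, rfl⟩; exact ⟨_, rfl⟩))⟩ :
      lp (fun N : R'.Model => N.carrier) ∞)
  map_one' := rfl
  map_mul' _ _ := rfl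
  map_zero' := rfl
  map_add' _ _ := rfl
  commutes' _ := rfl
  map_star' _ := rfl

section Lift

variable (T : X → R'.Universal) (hT : ∀ N : R'.Model, R.Holds N.carrier fun x => N.eval (T x))

theorem productMap_mem_universalSubalgebra (a : R.Universal) :
    productMap (fun N x => N.eval (T x)) hT a.1 ∈ R'.universalSubalgebra := by
  have hcont : Continuous (productMap (fun N x => N.eval (T x)) hT) := map_continuous _
  have hle : R.universalSubalgebra ≤
      R'.universalSubalgebra.comap (productMap (fun N x => N.eval (T x)) hT) := by
    refine StarSubalgebra.topologicalClosure_minimal (StarAlgebra.adjoin_le ?_)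
      ((StarSubalgebra.isClosed_topologicalClosure _).preimage hcont)
    rintro _ ⟨x, rfl⟩
    exact (T x).2
  exact hle a.2

/-- The universal property of `R.Universal`, for families in another universal algebra: by
`universal_ext` it is enough to impose the relations in every model. -/
noncomputable def lift : R.Universal →⋆ₐ[ℂ] R'.Universal :=
  StarAlgHom.codRestrict ((productMap (fun N x => N.eval (T x)) hT).comp
    R.universalSubalgebra.subtype) R'.universalSubalgebra
    (productMap_mem_universalSubalgebra T hT)

theorem lift_generator (x : X) : lift T hT (R.generator x) = T x := rfl

end Lift

end PartialIsometryRelations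

open MarkovWord Semigroupoid PartialIsometryRelations in
theorem theorem6p2_general {𝒢 : Type u} (A : Matrix 𝒢 𝒢 ℤ) (hA : ∀ i j, A i j = 0 ∨ A i j = 1) :
    Nonempty (Semigroupoid.UnitalCStarAlgebra (MarkovWord A) ≃⋆ₐ[ℂ]
      UnitalCuntzKriegerAlgebra A) := by
  let φ : UnitalCStarAlgebra (MarkovWord A) →⋆ₐ[ℂ] UnitalCuntzKriegerAlgebra A :=
    lift (wordProd (cuntzKriegerRelations A).generator) fun N => by
      simp only [map_wordProd, Model.eval_generator]
      refine (N.holds.isRepresentation_wordProd hA).isTight_of_isCuntzKriegerFamily ?_ hA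
      simp only [wordProd_single]
      exact N.holds
  let ψ : UnitalCuntzKriegerAlgebra A →⋆ₐ[ℂ] UnitalCStarAlgebra (MarkovWord A) :=
    lift (fun i => (tightRelations (MarkovWord A)).generator (single i)) fun N =>
      IsRepresentation.isCuntzKriegerFamily_of_isTight N.holds hA
  have hφ (α) : φ ((tightRelations (MarkovWord A)).generator α) =
      wordProd (cuntzKriegerRelations A).generator α := lift_generator _ _ α
  have hψ (i) : ψ ((cuntzKriegerRelations A).generator i) =
      (tightRelations (MarkovWord A)).generator (single i) := lift_generator _ _ i
  refine ⟨.ofStarAlgHom φ ψ (universal_hom_ext fun α => ?_) (universal_hom_ext fun i => ?_)⟩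
  · refine (congrArg ψ (hφ α)).trans (universal_ext fun N => ?_)
    simp only [map_wordProd, hψ, Model.eval_generator]
    exact N.holds.toIsRepresentation.wordProd_single α
  · exact (congrArg φ (hψ i)).trans ((hφ _).trans (wordProd_single _ i))

theorem theorem6p2 {𝒢 : Type u} (A : Matrix 𝒢 𝒢 ℤ) (hA : ∀ i j, A i j = 0 ∨ A i j = 1)
    (hrow : ∀ i, ∃ j, A i j ≠ 0) :
    Nonempty (Semigroupoid.UnitalCStarAlgebra (MarkovWord A) ≃⋆ₐ[ℂ]
      UnitalCuntzKriegerAlgebra A) :=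
  theorem6p2_general A hA
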